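/- A \emph{set functor} is an endofunctor $H$ of the category $\mathsf{Set}$ of sets and functions. It is \emph{finitary} if it preserves filtered colimits. It is \emph{substantially constant} if its restriction to the full subcategory of nonempty sets is naturally isomorphic to a constant functor. A cardinal $\lambda$ (regarded as the set of all smaller ordinals) is a \emph{fixpoint} of $H$ if $|H\lambda| = \lambda$. Theorem. Let $H$ be a set functor that is not substantially constant. Then $H$ is finitary if and only if there is a cardinal $\lambda_0$ such that every cardinal $\lambda \geq \lambda_0$ is a fixpoint of $H$. -/

import Mathlib

open CategoryTheory CategoryTheory.Limits Cardinal

universe u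

/-- The restriction of a set functor `H` to the full subcategory of nonempty sets. -/
def restrictNonempty (H : Type u ⥤ Type u) :
    ObjectProperty.FullSubcategory (fun X : Type u => Nonempty X) ⥤ Type u :=
  ObjectProperty.ι (fun X : Type u => Nonempty X) ⋙ H

/-- A set functor is substantially constant if its restriction to the nonempty sets is
naturally isomorphic to a constant functor. -/
def IsSubstantiallyConstant (H : Type u ⥤ Type u) : Prop :=
  ∃ M : Type u, Nonempty (restrictNonempty H ≅ (Functor.const _).obj M)

/-- A set functor is finitary if it preserves (small) filtered colimits. -/
def IsFinitary (H : Type u ⥤ Type u) : Prop :=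
  PreservesFilteredColimitsOfSize.{u, u} H

/-- The cardinal `c` is a fixpoint of `H` if `|H c| = c`, where `c` is regarded as the set of
all ordinals smaller than (the initial ordinal of) `c`. -/
def IsFixpoint (H : Type u ⥤ Type u) (c : Cardinal.{u}) : Prop :=
  #(H.obj c.ord.ToType) = c

/-! Being finitary amounts to every element of `H X` coming from a finite set. Then `H Z` is covered
by finite lists over `Z` with labels from a fixed set, so `#(H.obj Z) ≤ #Z` for large `Z`; failure
of substantial constancy gives the reverse inequality. For the converse, take an element `y` of some
`H I` whose least support size is an infinite `#I`, with `I` ordered as an initial ordinal. If a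
bijection `e` from `H M` to `M` existed for a suitable disjoint union `M` of rapidly growing blocks
indexed by `I`, a diagonal choice of one point per block would embed `I` in `M` so that the image of
`y` has a support meeting the chosen points in fewer than `#I` of them. Since `H` preserves nonempty
intersections, this contradicts minimality (`exists_mk_obj_ne`). -/

/-- The action of a set functor on plain functions. -/
def setMap (H : Type u ⥤ Type u) {X Y : Type u} (f : X → Y) (x : H.obj X) : H.obj Y :=
  H.map (↾f) x

/-! ### Injections and intersections under a set functor -/

section SetMap

variable (H : Type u ⥤ Type u) {X Y Z : Type u}

theorem setMap_id (x : H.obj X) : setMap H id x = x := by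
  have : (↾(id : X → X)) = 𝟙 X := rfl
  simp [setMap, this]

theorem setMap_comp (g : Y → Z) (f : X → Y) (x : H.obj X) :
    setMap H (g ∘ f) x = setMap H g (setMap H f x) := by
  have : (↾(g ∘ f)) = (↾f) ≫ (↾g) := rfl
  simp [setMap, this]

theorem setMap_leftInverse {g : Y → X} {f : X → Y} (h : Function.LeftInverse g f) :
    Function.LeftInverse (setMap H g) (setMap H f) := by
  intro x
  rw [← setMap_comp, h.comp_eq_id, setMap_id]

theorem setMap_injective {f : X → Y} (hf : Function.Injective f) (h : Nonempty X ∨ IsEmpty Y) :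
    Function.Injective (setMap H f) := by
  have : ∃ g : Y → X, Function.LeftInverse g f := by
    rcases h with h | h
    · exact hf.hasLeftInverse
    · exact ⟨fun y => h.elim y, fun x => h.elim (f x)⟩
  obtain ⟨g, hg⟩ := this
  exact (setMap_leftInverse H hg).injective

/-- Set functors preserve nonempty binary intersections. -/
theorem exists_setMap_inter {A B : Set X} (hAB : (A ∩ B).Nonempty) {x : H.obj X}
    (hA : ∃ a : H.obj A, setMap H Subtype.val a = x)
    (hB : ∃ b : H.obj B, setMap H Subtype.val b = x) :
    ∃ c : H.obj ↥(A ∩ B), setMap H Subtype.val c = x := by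
  classical
  obtain ⟨a, ha⟩ := hA
  obtain ⟨b, hb⟩ := hB
  obtain ⟨t, ht⟩ := hAB
  -- `p` retracts `X` onto `A`, sending the complement to `t`. As `t` lies in `B` too, `p` maps `B`
  -- into `A ∩ B`.
  let p : X → X := fun y => if y ∈ A then y else t
  have hpx : setMap H p x = x := by
    conv_lhs => rw [← ha, ← setMap_comp]
    rw [show p ∘ (Subtype.val : A → X) = Subtype.val from funext fun y => if_pos y.2, ha]
  have hpB (y : B) : p y.1 ∈ A ∩ B := by
    by_cases hy : (y : X) ∈ A
    · simp [p, hy]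
    · simpa [p, hy] using ht
  refine ⟨setMap H (fun y => ⟨p y.1, hpB y⟩) b, ?_⟩
  conv_rhs => rw [← hpx, ← hb, ← setMap_comp]
  rw [← setMap_comp]
  rfl

end SetMap

/-- Every element of every `H X` comes from a finite set. -/
def IsFinitelySupported (H : Type u ⥤ Type u) : Prop :=
  ∀ (X : Type u) (x : H.obj X), ∃ T : Type u, Finite T ∧ ∃ (f : T → X) (t : H.obj T),
    setMap H f t = x

/-! ### Finitary functors and finite supports -/

section Finitary

variable (H : Type u ⥤ Type u)

/-- The directed diagram of the finite subsets of a set. -/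
def finiteSubsets (X : Type u) : Finset X ⥤ Type u where
  obj S := ↥S
  map f := ↾fun a => ⟨a.1, leOfHom f a.2⟩
  map_id _ := rfl
  map_comp _ _ := rfl

/-- A set as a cocone over its finite subsets. -/
def finiteSubsetsCocone (X : Type u) : Cocone (finiteSubsets X) where
  pt := X
  ι := { app := fun S => ↾fun a : ↥S => a.1
         naturality := fun _ _ _ => rfl }

/-- A set is the directed colimit of its finite subsets. -/
noncomputable def finiteSubsetsIsColimit (X : Type u) : IsColimit (finiteSubsetsCocone X) := by
  classical
  refine Types.FilteredColimit.isColimitOf' _ _ (fun x => ?_) (fun S a b h => ?_)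
  · exact ⟨({x} : Finset X), (⟨x, Finset.mem_singleton_self x⟩ : ↥({x} : Finset X)), rfl⟩
  · exact ⟨S, 𝟙 S, congrArg _ (Subtype.ext h)⟩

theorem IsFinitary.isFinitelySupported {H : Type u ⥤ Type u} (hH : IsFinitary H) :
    IsFinitelySupported H := by
  classical
  intro X x
  have : PreservesFilteredColimitsOfSize.{u, u} H := hH
  have hc := isColimitOfPreserves H (finiteSubsetsIsColimit X)
  obtain ⟨S, t, ht⟩ := Types.jointly_surjective_of_isColimit hc x
  exact ⟨↥S, inferInstance, Subtype.val, t, ht⟩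

/-- Finitely many identifications made in a filtered colimit already happen at one later stage.
Nonemptiness is tracked because `H` need not preserve injections with empty domain. -/
theorem exists_injOn_stage {J : Type u} [Category.{u} J] [IsFiltered J] {D : J ⥤ Type u}
    {c : Cocone D} (hc : IsColimit c) {i : J} {S : Type u} [Finite S] (g : S → D.obj i) :
    ∃ (k : J) (φ : i ⟶ k), (∀ s s', c.ι.app i (g s) = c.ι.app i (g s') →
      D.map φ (g s) = D.map φ (g s')) ∧ (Nonempty c.pt → Nonempty (D.obj k)) := by
  classical
  obtain ⟨j, hj⟩ : ∃ j : J, Nonempty c.pt → Nonempty (D.obj j) := by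
    by_cases h : Nonempty c.pt
    · obtain ⟨j, d, -⟩ := Types.jointly_surjective_of_isColimit hc h.some
      exact ⟨j, fun _ => ⟨d⟩⟩
    · exact ⟨i, fun h' => absurd h' h⟩
  have hp (p : S × S) : ∃ k : Under i, c.ι.app i (g p.1) = c.ι.app i (g p.2) →
      D.map k.hom (g p.1) = D.map k.hom (g p.2) := by
    by_cases h : c.ι.app i (g p.1) = c.ι.app i (g p.2)
    · obtain ⟨k, φ, hk⟩ := (Types.FilteredColimit.isColimit_eq_iff' hc _ _).1 h
      exact ⟨Under.mk φ, fun _ => hk⟩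
    · exact ⟨Under.mk (𝟙 i), fun h' => absurd h' h⟩
  choose k hk using hp
  have := Fintype.ofFinite S
  let j' : Under i := Under.mk (IsFiltered.leftToMax i j)
  obtain ⟨m, hm⟩ := IsFiltered.sup_objs_exists (insert j' (Finset.univ.image k))
  refine ⟨m.right, m.hom, fun s s' h => ?_, fun h => ?_⟩
  · obtain ⟨ψ⟩ := hm (X := k (s, s')) (by simp)
    rw [← Under.w ψ, Functor.map_comp, comp_apply, comp_apply, hk (s, s') h]
  · obtain ⟨ψ⟩ := hm (X := j') (by simp)
    obtain ⟨d⟩ := hj h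
    exact ⟨D.map ψ.right (D.map (IsFiltered.rightToMax i j) d)⟩

theorem IsFinitelySupported.isFinitary {H : Type u ⥤ Type u} (hH : IsFinitelySupported H) :
    IsFinitary H := by
  refine ⟨fun J _ _ => ⟨fun {D} => ⟨fun {c} hc => ⟨?_⟩⟩⟩⟩
  refine Types.FilteredColimit.isColimitOf' _ _ (fun x => ?_) (fun i a b hab => ?_)
  · obtain ⟨T, _, f, t, rfl⟩ := hH _ x
    have hf (s : T) := Types.jointly_surjective_of_isColimit hc (f s)
    choose j d hd using hf
    classical
    have := Fintype.ofFinite T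
    obtain ⟨k, hk⟩ := IsFiltered.sup_objs_exists (Finset.univ.image j)
    have φ (s : T) : j s ⟶ k := (hk (X := j s) (by simp)).some
    refine ⟨k, setMap H (fun s => D.map (φ s) (d s)) t, ?_⟩
    change _ = setMap H (fun a => c.ι.app k a) _
    rw [← setMap_comp]
    congr 1
    funext s
    rw [← hd s]
    exact (ConcreteCategory.congr_hom (c.w (φ s)) (d s)).symm
  · obtain ⟨T₁, _, f₁, t₁, rfl⟩ := hH _ a
    obtain ⟨T₂, _, f₂, t₂, rfl⟩ := hH _ b
    obtain ⟨k, φ, hφ, hne⟩ := exists_injOn_stage hc (Sum.elim f₁ f₂)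
    refine ⟨k, φ, ?_⟩
    have hw (x : D.obj i) : c.ι.app k (D.map φ x) = c.ι.app i x := ConcreteCategory.congr_hom (c.w φ) x
    let g : T₁ ⊕ T₂ → D.obj k := fun s => D.map φ (Sum.elim f₁ f₂ s)
    -- `R` contains both supports at stage `k` and embeds in the colimit. `H` keeps this embedding
    -- injective, so the equality in the colimit descends to `H R`.
    obtain ⟨R, hgR, hR, hRne⟩ : ∃ R : Set (D.obj k), (∀ s, g s ∈ R) ∧
        Set.InjOn (fun a => c.ι.app k a) R ∧ (Nonempty R ∨ IsEmpty c.pt) := by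
      have hg : Set.InjOn (fun a => c.ι.app k a) (Set.range g) := by
        rintro _ ⟨s, rfl⟩ _ ⟨s', rfl⟩ h
        exact hφ s s' (by simpa only [g, hw] using h)
      rcases isEmpty_or_nonempty c.pt with h | h
      · exact ⟨Set.range g, fun s => ⟨s, rfl⟩, hg, Or.inr h⟩
      · rcases isEmpty_or_nonempty (T₁ ⊕ T₂) with h' | ⟨⟨s⟩⟩
        · obtain ⟨d⟩ := hne h
          exact ⟨{d}, fun s => h'.elim s, Set.injOn_singleton _ _, Or.inl ⟨d, rfl⟩⟩
        · exact ⟨Set.range g, fun s => ⟨s, rfl⟩, hg, Or.inl ⟨g s, s, rfl⟩⟩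
    have hinj := setMap_injective H (f := fun a : R => c.ι.app k a.1)
      (fun a b h => Subtype.ext (hR a.2 b.2 h)) hRne
    have h₁ : setMap H (fun s => (⟨g (.inl s), hgR _⟩ : R)) t₁ =
        setMap H (fun s => (⟨g (.inr s), hgR _⟩ : R)) t₂ := by
      apply hinj
      rw [← setMap_comp, ← setMap_comp]
      change setMap H (Y := c.pt) (fun a => c.ι.app i a) _ =
        setMap H (Y := c.pt) (fun a => c.ι.app i a) _ at hab
      rw [← setMap_comp, ← setMap_comp] at hab
      have e₁ : (fun a : R => (c.ι.app k a.1 : c.pt)) ∘ (fun s => ⟨g (.inl s), hgR _⟩) =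
          (fun a => (c.ι.app i a : c.pt)) ∘ f₁ := funext fun s => hw _
      have e₂ : (fun a : R => (c.ι.app k a.1 : c.pt)) ∘ (fun s => ⟨g (.inr s), hgR _⟩) =
          (fun a => (c.ι.app i a : c.pt)) ∘ f₂ := funext fun s => hw _
      exact (congrArg (fun q => setMap H q t₁) e₁).trans
        (hab.trans (congrArg (fun q => setMap H q t₂) e₂).symm)
    have h₂ := congrArg (setMap H Subtype.val) h₁
    rw [← setMap_comp, ← setMap_comp] at h₂
    change setMap H (fun a => D.map φ a) _ = setMap H (fun a => D.map φ a) _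
    rw [← setMap_comp, ← setMap_comp]
    exact h₂

theorem isFinitary_iff_isFinitelySupported : IsFinitary H ↔ IsFinitelySupported H :=
  ⟨IsFinitary.isFinitelySupported, IsFinitelySupported.isFinitary⟩

end Finitary

/-! ### Cardinality bounds for large sets -/

section Bounds

variable {H : Type u ⥤ Type u}

/-- A set functor that is not substantially constant has an element that is moved differently by
two maps. -/
theorem exists_setMap_ne (hH : ¬ IsSubstantiallyConstant H) :
    ∃ (X Y : Type u) (y : H.obj X) (f g : X → Y), Nonempty X ∧ setMap H f y ≠ setMap H g y := by
  by_contra! h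
  -- All parallel maps out of a nonempty set now act alike, so constant self-maps act as the
  -- identity.
  refine hH ⟨H.obj PUnit, ⟨NatIso.ofComponents (fun X => Equiv.toIso
    { toFun := setMap H fun _ => PUnit.unit
      invFun := setMap H fun _ => X.2.some
      left_inv := fun x => ?_
      right_inv := fun x => ?_ }) ?_⟩⟩
  · exact (setMap_comp H _ _ x).symm.trans ((h _ _ x _ id X.2).trans (setMap_id H x))
  · exact (setMap_comp H _ _ x).symm.trans (setMap_id H x)
  · intro X Y f
    ext x
    exact (setMap_comp H _ _ x).symm

theorem exists_le_mk_obj (hH : ¬ IsSubstantiallyConstant H) :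
    ∃ c₀ : Cardinal.{u}, ∀ Z : Type u, c₀ ≤ #Z → #Z ≤ #(H.obj Z) := by
  classical
  obtain ⟨X, Y, y, f, g, hX, hfg⟩ := exists_setMap_ne hH
  refine ⟨max ℵ₀ #X, fun Z hZ => ?_⟩
  have hZX : #(Z × X) = #Z := by
    rw [mk_prod, lift_id, lift_id]
    exact mul_eq_left ((le_max_left _ _).trans hZ) ((le_max_right _ _).trans hZ) (mk_ne_zero X)
  obtain ⟨e⟩ := Cardinal.eq.1 hZX
  refine mk_le_of_injective (f := fun z => setMap H (fun x => e (z, x)) y) fun z w hzw => ?_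
  by_contra hne
  -- `q` restricts to `f` on the copy of `X` over `z` and to `g` on every other copy, so it
  -- separates the copies of `y` over `z` and `w`.
  let q : Z → Y := fun a => if (e.symm a).1 = z then f (e.symm a).2 else g (e.symm a).2
  apply hfg
  have := congrArg (setMap H q) hzw
  simp only [← setMap_comp] at this
  convert this using 2 <;> funext x
  · simp [q]
  · simp [q, Ne.symm hne]

theorem IsFinitelySupported.exists_mk_obj_le (hH : IsFinitelySupported H) :
    ∃ c₀ : Cardinal.{u}, ∀ Z : Type u, c₀ ≤ #Z → #(H.obj Z) ≤ #Z := by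
  let E := Σ n : ℕ, H.obj (ULift.{u} (Fin n))
  refine ⟨max ℵ₀ #E, fun Z hZ => ?_⟩
  have : Infinite Z := infinite_iff.2 ((le_max_left _ _).trans hZ)
  -- The default value only makes `F` total; the lists used for surjectivity have exactly length
  -- `n`.
  let F : List Z × E → H.obj Z := fun p =>
    setMap H (fun i => p.1.getD i.down.1 (Classical.arbitrary Z)) p.2.2
  have hF : Function.Surjective F := by
    intro x
    obtain ⟨T, _, f, t, rfl⟩ := hH Z x
    obtain ⟨n, ⟨e⟩⟩ := Finite.exists_equiv_fin T
    refine ⟨(List.ofFn fun i => f (e.symm i), ⟨n, setMap H (fun s => ⟨e s⟩) t⟩), ?_⟩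
    simp only [F]
    rw [← setMap_comp]
    congr 1
    funext s
    simp
  calc #(H.obj Z) ≤ #(List Z × E) := mk_le_of_surjective hF
    _ = #Z * #E := by rw [mk_prod, lift_id, lift_id, mk_list_eq_mk]
    _ ≤ #Z * #Z := mul_le_mul_right ((le_max_right _ _).trans hZ) _
    _ = #Z := mul_eq_self (aleph0_le_mk Z)

/-! ### The diagonal argument -/

/-- A well-ordered family of sets, each much larger than the union of the previous ones. -/
theorem exists_rapidly_growing {I : Type u} [LinearOrder I] [WellFoundedLT I]
    (c₀ d : Cardinal.{u}) :
    ∃ S : I → Type u, ∀ i, c₀ ≤ #(S i) ∧ #(Σ j : Set.Iio i, S j) * d < #(S i) := by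
  let κ : I → Cardinal.{u} := (wellFounded_lt (α := I)).fix fun i rec =>
    Order.succ (max c₀ ((Cardinal.sum fun j : Set.Iio i => rec j.1 j.2) * d))
  have hκ (i : I) : κ i = Order.succ (max c₀ ((Cardinal.sum fun j : Set.Iio i => κ j) * d)) :=
    WellFounded.fix_eq _ _ _
  refine ⟨fun i => (κ i).out, fun i => ?_⟩
  simp only [mk_sigma, mk_out]
  rw [hκ i]
  exact ⟨(le_max_left _ _).trans (Order.le_succ _),
    (le_max_right _ _).trans_lt (Order.lt_succ _)⟩

/-- An element of `H I` that does not come from fewer than `|I|` points forces `|H M| ≠ |M|` for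
arbitrarily large sets `M`. -/
theorem exists_mk_obj_ne {I : Type u} [LinearOrder I] [WellFoundedLT I] [Infinite I]
    (hI : ∀ i : I, #(Set.Iio i) < #I) (y : H.obj I)
    (hy : ∀ (U : Type u) (g : U → I) (v : H.obj U), setMap H g v = y → #I ≤ #U)
    (c₀ : Cardinal.{u}) : ∃ M : Type u, c₀ ≤ #M ∧ #(H.obj M) ≠ #M := by
  classical
  obtain ⟨S, hS⟩ := exists_rapidly_growing (I := I) c₀ #I
  let i₀ : I := Classical.arbitrary I
  refine ⟨Σ i, S i, (hS i₀).1.trans (mk_le_of_injective (f := Sigma.mk i₀) sigma_mk_injective),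
    fun hM => ?_⟩
  obtain ⟨e⟩ := Cardinal.eq.1 hM
  -- `A h` is a support of `h` of size at most `#I` whenever one exists, and junk otherwise.
  have hA (h : H.obj (Σ i, S i)) : ∃ A : Set (Σ i, S i), #A ≤ #I ∧
      ∀ B : Set (Σ i, S i), #B ≤ #I → (∃ v : H.obj B, setMap H Subtype.val v = h) →
        ∃ v : H.obj A, setMap H Subtype.val v = h := by
    by_cases hB : ∃ B : Set (Σ i, S i), #B ≤ #I ∧ ∃ v : H.obj B, setMap H Subtype.val v = h
    · obtain ⟨B, hB, hv⟩ := hB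
      exact ⟨B, hB, fun _ _ _ => hv⟩
    · exact ⟨∅, by simp, fun B h₁ h₂ => absurd ⟨B, h₁, h₂⟩ hB⟩
  choose A hAI hA using hA
  -- The diagonal choice: the sets `A h` with `e h` in a block before `i` have a union too small to
  -- cover block `i`.
  have hs (i : I) : ∃ s : S i, ∀ h, (e h).1 < i → (⟨i, s⟩ : Σ i, S i) ∉ A h := by
    by_contra! hcon
    let bad : Set (Σ i, S i) := ⋃ p : Σ j : Set.Iio i, S j, A (e.symm ⟨p.1, p.2⟩)
    have hbad : #bad < #(S i) := by
      refine (mk_iUnion_le _).trans_lt (lt_of_le_of_lt ?_ (hS i).2)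
      exact mul_le_mul_right (ciSup_le' fun p => hAI _) _
    refine hbad.not_ge (mk_le_of_injective (f := fun s : S i => (⟨⟨i, s⟩, ?_⟩ : bad)) ?_)
    · obtain ⟨h, hi, hm⟩ := hcon s
      refine Set.mem_iUnion.2 ⟨⟨⟨(e h).1, hi⟩, (e h).2⟩, ?_⟩
      simpa using hm
    · intro s s' hss
      exact sigma_mk_injective (congrArg Subtype.val hss)
  choose s hs using hs
  let b : I → Σ i, S i := fun i => ⟨i, s i⟩
  have hb : Function.LeftInverse Sigma.fst b := fun _ => rfl
  set h := setMap H b y with hh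
  have hrange : ∃ v : H.obj (Set.range b), setMap H Subtype.val v = h :=
    ⟨setMap H (Set.rangeFactorization b) y, (setMap_comp H _ _ y).symm⟩
  obtain ⟨v, hv⟩ := hA h _ mk_range_le hrange
  -- Adding `b i₀` makes the intersection with `Set.range b` nonempty.
  have hinsert : ∃ w : H.obj ↥(insert (b i₀) (A h)), setMap H Subtype.val w = h :=
    ⟨setMap H (Set.inclusion (Set.subset_insert _ _)) v, by rw [← setMap_comp]; exact hv⟩
  obtain ⟨w, hw⟩ := exists_setMap_inter H
    (⟨b i₀, Set.mem_insert _ _, i₀, rfl⟩ : (insert (b i₀) (A h) ∩ Set.range b).Nonempty)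
    hinsert hrange
  have hle : #I ≤ #↥(insert (b i₀) (A h) ∩ Set.range b) := by
    refine hy _ (fun p => p.1.1) w ?_
    rw [show (fun p : ↥(insert (b i₀) (A h) ∩ Set.range b) => p.1.1) =
      Sigma.fst ∘ Subtype.val from rfl, setMap_comp, hw, hh, setMap_leftInverse H hb]
  -- By the choice of `s`, `A h` misses `b j` for every `j` beyond `(e h).1`, leaving fewer than
  -- `#I` points.
  have hsub : insert (b i₀) (A h) ∩ Set.range b ⊆
      b '' insert i₀ (insert (e h).1 (Set.Iio (e h).1)) := by
    rintro _ ⟨hmem, j, rfl⟩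
    refine ⟨j, ?_, rfl⟩
    rcases hmem with hmem | hmem
    · exact Or.inl (hb.injective hmem)
    · right
      rcases lt_trichotomy j (e h).1 with hlt | heq | hgt
      · exact Or.inr hlt
      · exact Or.inl heq
      · exact absurd hmem (hs j h hgt)
  have hone : (1 : Cardinal.{u}) < #I := one_lt_aleph0.trans_le (aleph0_le_mk I)
  refine hle.not_gt (((mk_le_mk_of_subset hsub).trans (mk_image_le.trans mk_insert_le)).trans_lt ?_)
  exact add_lt_of_lt (aleph0_le_mk I)
    (mk_insert_le.trans_lt (add_lt_of_lt (aleph0_le_mk I) (hI _) hone)) hone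

theorem isFinitelySupported_of_mk_obj_eq {c₀ : Cardinal.{u}}
    (hc₀ : ∀ M : Type u, c₀ ≤ #M → #(H.obj M) = #M) : IsFinitelySupported H := by
  by_contra hH
  unfold IsFinitelySupported at hH
  push Not at hH
  obtain ⟨X, x, hx⟩ := hH
  -- A support of `x` of least cardinality is infinite, and `t` itself then comes from no smaller
  -- set.
  let P : Set Cardinal.{u} := {d | ∃ (T : Type u) (f : T → X) (t : H.obj T),
    #T = d ∧ setMap H f t = x}
  have hP : P.Nonempty := ⟨#X, X, id, x, rfl, setMap_id H x⟩
  obtain ⟨T, f, t, hT, ht⟩ := csInf_mem hP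
  have : Infinite T := not_finite_iff_infinite.1 fun hfin => hx T hfin f t ht
  obtain ⟨e⟩ : Nonempty ((#T).ord.ToType ≃ T) := Cardinal.eq.1 (mk_ord_toType _)
  have : Infinite (#T).ord.ToType := e.infinite_iff.2 this
  obtain ⟨M, hM, hne⟩ := exists_mk_obj_ne (H := H) (I := (#T).ord.ToType)
    (fun i => mk_Iio_lt i (by simp)) (setMap H e.symm t)
    (fun U g v hv => by
      rw [mk_ord_toType, hT]
      refine csInf_le' ⟨U, f ∘ e ∘ g, v, rfl, ?_⟩
      rw [setMap_comp, setMap_comp, hv, setMap_leftInverse H e.rightInverse_symm, ht]) c₀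
  exact hne (hc₀ M hM)

theorem mk_obj_congr (H : Type u ⥤ Type u) {X Y : Type u} (h : #X = #Y) :
    #(H.obj X) = #(H.obj Y) := by
  obtain ⟨e⟩ := Cardinal.eq.1 h
  exact mk_congr (H.mapIso e.toIso).toEquiv

theorem forall_isFixpoint_iff (H : Type u ⥤ Type u) (c₀ : Cardinal.{u}) :
    (∀ c, c₀ ≤ c → IsFixpoint H c) ↔ ∀ M : Type u, c₀ ≤ #M → #(H.obj M) = #M := by
  refine ⟨fun h M hM => ?_, fun h c hc => ?_⟩
  · exact (mk_obj_congr H (mk_ord_toType #M).symm).trans (h _ hM)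
  · exact (h _ (by rwa [mk_ord_toType])).trans (mk_ord_toType c)

end Bounds

theorem mainTheorem7 (H : Type u ⥤ Type u) (hH : ¬ IsSubstantiallyConstant H) :
    IsFinitary H ↔ ∃ c₀ : Cardinal.{u}, ∀ c : Cardinal.{u}, c₀ ≤ c → IsFixpoint H c := by
  simp only [forall_isFixpoint_iff, isFinitary_iff_isFinitelySupported]
  constructor
  · intro hfin
    obtain ⟨c₁, h₁⟩ := exists_le_mk_obj hH
    obtain ⟨c₂, h₂⟩ := hfin.exists_mk_obj_le
    exact ⟨max c₁ c₂, fun M hM => le_antisymm (h₂ M ((le_max_right _ _).trans hM))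
      (h₁ M ((le_max_left _ _).trans hM))⟩
  · rintro ⟨c₀, hc₀⟩
    exact isFinitelySupported_of_mk_obj_eq hc₀
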